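/- Conventions: graphs are finite and undirected, without parallel edges; loops are allowed, and a loop contributes $1$ to the degree of its vertex (simple graphs are the loopless case). For a graph $G=(V,E)$ and $S\subseteq V$ let $\operatorname{vol}(S)$ be the sum of the degrees of the vertices in $S$ and $e(S,\overline S)$ the number of edges between $S$ and its complement $\overline S$. The conductance $\Phi(G)$ is the minimum of $e(S,\overline S)/\min\{\operatorname{vol}(S),\operatorname{vol}(\overline S)\}$ over all $S\subseteq V$ with $\operatorname{vol}(S)\ne0$ and $\operatorname{vol}(\overline S)\neq 0$ (it is $+\infty$ if there is no such $S$). For $\delta>0$, $G$ is a $\delta$-expander if it has no isolated vertices (vertices of degree $0$) and $\Phi(G)>\delta$. For an injective map $A=(a_v)_{v\in V}$ from $V$ to $\mathbb Z$ put $A+_GA=\{a_u+a_v: uv\in E\}$. For $T\subseteq\mathbb Z_n$, the Cayley sum graph $G(\mathbb Z_n,T)$ has vertex set $\mathbb Z_n$, and $y,z$ (possibly equal) are adjacent if and only if $y+z\in T$. Theorem. For every $0<\delta<\frac12$ there are constants $C,c>0$, depending only on $\delta$, such that: 1. If $G$ is a $\delta$-expander on $n$ vertices, then $|A+_GA|\ge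 c\log n$ for every labelling $A$ of its vertices by $n$ distinct integers. 2. For every $n\ge2$ there is a regular $\delta$-expander $G$ on $n$ vertices with $|A+_GA|\le C\log n$ for $A=\{1,2,\dots,n\}$. Moreover, $G$ can be taken to be a Cayley sum graph $G(\mathbb Z_n,T)$ that is $|T|$-regular, with $c\log n\le|T|\le C\log n$, where each vertex is labelled by its representative in $\{1,\dots,n\}$. Moreover, the dependence of $c$ on $\delta$ in part 1 can be made explicit: there is an absolute constant $c_0>0$ such that for all $0<\delta<\frac12$, every $\delta$-expander $G$ on $n$ vertices and every labelling $A$ of its vertices by $n$ distinct integers, $|A+_GA|\ge c_0\,\frac{\log n}{\log(1/\delta)}$. -/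

import Mathlib

/-- An undirected graph on `V` without parallel edges, in which loops are allowed (a Cayley sum
graph has a loop at `y` whenever `y + y` is a generator). Simple graphs are the case in which
`Adj` is irreflexive. -/
structure LoopGraph (V : Type*) where
  Adj : V → V → Prop
  symm : ∀ u v, Adj u v → Adj v u

namespace LoopGraph

variable {V : Type*}

/-- The sum-set `{a u + a v : uv an edge}` of the labelling `a` along `G`. -/
def sumSet (G : LoopGraph V) {R : Type*} [Add R] (a : V → R) : Set R :=
  {x | ∃ u v, G.Adj u v ∧ a u + a v = x}

open Classical in
/-- The number of `w` with `vw` an edge; a loop at `v` counts once. -/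
noncomputable def degree (G : LoopGraph V) [Fintype V] (v : V) : ℕ :=
  (Finset.univ.filter fun w => G.Adj v w).card

/-- The volume of a vertex set: the sum of its degrees. -/
noncomputable def vol (G : LoopGraph V) [Fintype V] (S : Finset V) : ℕ :=
  ∑ v ∈ S, G.degree v

open Classical in
/-- The number of edges between `S` and its complement, each edge counted once (from its
endpoint in `S`). -/
noncomputable def cut (G : LoopGraph V) [Fintype V] (S : Finset V) : ℕ :=
  ((S ×ˢ Sᶜ).filter fun p => G.Adj p.1 p.2).card

open Classical in
/-- The conductance: the minimum of `e(S, Sᶜ) / min (vol S) (vol Sᶜ)` over all vertex sets `S` for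
which the quotient is defined (`vol S ≠ 0` and `vol Sᶜ ≠ 0`). The minimum over no sets is `⊤`. -/
noncomputable def conductance (G : LoopGraph V) [Fintype V] : ENNReal :=
  (Finset.univ.filter fun S : Finset V => G.vol S ≠ 0 ∧ G.vol Sᶜ ≠ 0).inf
    fun S => (G.cut S : ENNReal) / ((min (G.vol S) (G.vol Sᶜ) : ℕ) : ENNReal)

/-- `G` is a `δ`-expander: `δ > 0`, there are no isolated vertices, and the conductance
exceeds `δ`. -/
def IsExpander (G : LoopGraph V) [Fintype V] (δ : ℝ) : Prop :=
  0 < δ ∧ (∀ v, G.degree v ≠ 0) ∧ ENNReal.ofReal δ < G.conductance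

/-- Every vertex has degree `d`. -/
def IsRegular (G : LoopGraph V) [Fintype V] (d : ℕ) : Prop :=
  ∀ v, G.degree v = d

/-- The Cayley sum graph of an abelian group with respect to `T`: `y` and `z` (possibly equal) are
adjacent if and only if `y + z ∈ T`. -/
def cayleySum {Λ : Type*} [AddCommGroup Λ] (T : Finset Λ) : LoopGraph Λ where
  Adj y z := y + z ∈ T
  symm y z h := by rwa [add_comm]

end LoopGraph

/-! Lower bound: balls in an expander grow in volume by a factor 1 + δ until they exceed half the
total (`vol_ball`), so some radius k of order (log n)/δ suffices. Degrees are at most the size m of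
the sum-set, so such a ball has at least n/(2m) vertices. Crossing an edge uw replaces a u by s − a
u with s in the sum-set, so labels in the ball are ± a v plus integer combinations of the m sums
with ℓ¹ norm at most k (`exists_coeffs_of_mem_ball`). By commutativity only coefficient vectors
matter, and a generating function bounds their number by x⁻ᵏ(2/(1−x))ᵐ. With 1 − x of order δ this
is at most n^(1/4) (O(1)/δ)ᵐ, which forces m ≫ log n / log(1/δ).

Upper bound: a random T of expected size of order log n has all nontrivial character sums small
compared with |T| (`exists_finset_norm_charSum_le`), and expander mixing turns this into conductance
above δ. With labels 1, …, n, each residue in T accounts for at most two integer sums. -/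

namespace LoopGraph

/-! ### Volume growth of balls -/

section Basic

variable {V : Type*} [Fintype V] (G : LoopGraph V)

lemma vol_add_vol_compl [DecidableEq V] (S : Finset V) :
    G.vol S + G.vol Sᶜ = G.vol Finset.univ :=
  Finset.sum_add_sum_compl S _

lemma vol_mono {S T : Finset V} (h : S ⊆ T) : G.vol S ≤ G.vol T :=
  Finset.sum_le_sum_of_subset h

open Classical in
/-- The expander condition, stated over the reals. -/
lemma lt_conductance_iff {δ : ℝ} (hδ : 0 ≤ δ) :
    ENNReal.ofReal δ < G.conductance ↔ ∀ S : Finset V, G.vol S ≠ 0 → G.vol Sᶜ ≠ 0 →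
      δ * (min (G.vol S) (G.vol Sᶜ) : ℕ) < G.cut S := by
  unfold conductance
  rw [Finset.lt_inf_iff ENNReal.ofReal_lt_top]
  simp only [Finset.mem_filter, Finset.mem_univ, true_and, and_imp]
  refine forall_congr' fun S => forall_congr' fun h1 => forall_congr' fun h2 => ?_
  have hm : min (G.vol S) (G.vol Sᶜ) ≠ 0 := by
    rcases min_choice (G.vol S) (G.vol Sᶜ) with h | h <;> rw [h] <;> assumption
  rw [ENNReal.lt_div_iff_mul_lt (Or.inl (by exact_mod_cast hm)) (Or.inl (ENNReal.natCast_ne_top _))]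
  rw [← ENNReal.ofReal_natCast, ← ENNReal.ofReal_natCast, ← ENNReal.ofReal_mul hδ,
    ENNReal.ofReal_lt_ofReal_iff_of_nonneg (by positivity)]

open Classical in
/-- The vertices of `S` together with their neighbours. -/
noncomputable def closedNbhd (S : Finset V) : Finset V :=
  S ∪ Finset.univ.filter fun w => ∃ u ∈ S, G.Adj u w

open Classical in
-- Every cut edge ends in the closed neighbourhood outside `S`, where its outer endpoint's degree
-- counts it.
lemma vol_add_cut_le (S : Finset V) : G.vol S + G.cut S ≤ G.vol (G.closedNbhd S) := by
  have hsub : S ⊆ G.closedNbhd S := Finset.subset_union_left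
  have h := Finset.sum_sdiff (f := G.degree) hsub
  have hcut : G.cut S ≤ ∑ w ∈ G.closedNbhd S \ S, G.degree w := by
    unfold cut
    rw [Finset.card_eq_sum_card_fiberwise (f := Prod.snd) (t := G.closedNbhd S \ S)]
    · refine Finset.sum_le_sum fun w _ => ?_
      refine Finset.card_le_card_of_injOn Prod.fst ?_ ?_
      · rintro ⟨u, v⟩ h
        simp only [Finset.coe_filter, Finset.mem_filter, Finset.mem_product, Set.mem_ofPred_eq] at h
        obtain ⟨⟨_, h⟩, rfl⟩ := h
        simpa using G.symm _ _ h
      · rintro ⟨u, v⟩ h ⟨u', v'⟩ h' e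
        simp only [Finset.coe_filter, Set.mem_ofPred_eq] at h h'
        simp only at e
        ext <;> simp [e, h.2, h'.2]
    · rintro ⟨u, v⟩ h
      simp only [Finset.coe_filter, Finset.mem_product, Finset.mem_compl, Set.mem_ofPred_eq] at h
      simp only [closedNbhd, Finset.coe_sdiff, Set.mem_sdiff, Finset.mem_coe, Finset.mem_union,
        Finset.mem_filter, Finset.mem_univ, true_and]
      exact ⟨Or.inr ⟨u, h.1.1, h.2⟩, h.1.2⟩
  unfold vol
  omega

/-- The ball of radius `k` about a vertex. -/
noncomputable def ball (v : V) : ℕ → Finset V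
  | 0 => {v}
  | k + 1 => G.closedNbhd (ball v k)

open Classical in
lemma vol_ball {δ : ℝ} (hG : G.IsExpander δ) (v : V) (k : ℕ) :
    G.vol Finset.univ < 2 * G.vol (G.ball v k) ∨ (1 + δ) ^ k ≤ G.vol (G.ball v k) := by
  obtain ⟨hδ, hdeg, hcond⟩ := hG
  rw [lt_conductance_iff G hδ.le] at hcond
  have hsub : ∀ S, S ⊆ G.closedNbhd S := fun S => Finset.subset_union_left
  induction k with
  | zero =>
    right
    have := hdeg v
    simp only [ball, vol, Finset.sum_singleton, pow_zero]
    exact_mod_cast Nat.one_le_iff_ne_zero.2 this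
  | succ k ih =>
    have hmono : G.vol (G.ball v k) ≤ G.vol (G.ball v (k + 1)) := G.vol_mono (hsub _)
    by_cases hbig : G.vol Finset.univ < 2 * G.vol (G.ball v k)
    · left; omega
    right
    have ih := ih.resolve_left hbig
    have hpos : (0 : ℝ) < G.vol (G.ball v k) := lt_of_lt_of_le (by positivity) ih
    have hpos' : 0 < G.vol (G.ball v k) := by exact_mod_cast hpos
    have hc := G.vol_add_vol_compl (G.ball v k)
    have h := hcond (G.ball v k) hpos'.ne' (by omega)
    -- The ball holds at most half the volume, so the conductance bound is relative to the ball
    -- itself.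
    rw [min_eq_left (by omega)] at h
    have h2 : (G.vol (G.ball v k) + G.cut (G.ball v k) : ℝ) ≤ G.vol (G.ball v (k + 1)) := by
      exact_mod_cast G.vol_add_cut_le (G.ball v k)
    have h3 : (1 + δ) ^ (k + 1) ≤ (1 + δ) * G.vol (G.ball v k) := by
      rw [pow_succ, mul_comm]
      gcongr
    linarith

end Basic

/-! ### Counting integer vectors of bounded ℓ¹ norm -/

section WordCount

/-- Integer vectors of `ℓ¹` norm at most `k`. -/
noncomputable def smallCoeffs (ι : Type*) [Fintype ι] [DecidableEq ι] (k : ℕ) : Finset (ι → ℤ) :=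
  (Fintype.piFinset fun _ => Finset.Icc (-(k : ℤ)) k).filter fun c => ∑ i, (c i).natAbs ≤ k

lemma mem_smallCoeffs {ι : Type*} [Fintype ι] [DecidableEq ι] {k : ℕ} {c : ι → ℤ} :
    c ∈ smallCoeffs ι k ↔ ∑ i, (c i).natAbs ≤ k := by
  unfold smallCoeffs
  rw [Finset.mem_filter, and_iff_right_iff_imp]
  intro h
  rw [Fintype.mem_piFinset]
  intro i
  have := Finset.single_le_sum (f := fun i => (c i).natAbs) (fun _ _ => Nat.zero_le _)
    (Finset.mem_univ i)
  rw [Finset.mem_Icc]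
  omega

lemma sum_pow_natAbs_le {x : ℝ} (h0 : 0 ≤ x) (h1 : x < 1) (k : ℕ) :
    ∑ j ∈ Finset.Icc (-(k : ℤ)) k, x ^ j.natAbs ≤ 2 / (1 - x) := by
  rw [← Finset.sum_fiberwise_of_maps_to (g := Int.natAbs) (t := Finset.range (k + 1))
    (fun j hj => by rw [Finset.mem_Icc] at hj; rw [Finset.mem_range]; omega)]
  have h : ∀ i ∈ Finset.range (k + 1),
      ∑ j ∈ (Finset.Icc (-(k : ℤ)) k).filter (fun j => j.natAbs = i), x ^ j.natAbs
        ≤ 2 * x ^ i := by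
    intro i _
    rw [Finset.sum_congr rfl (g := fun _ => x ^ i)
      (fun j hj => by rw [(Finset.mem_filter.1 hj).2]), Finset.sum_const, nsmul_eq_mul]
    gcongr
    have : (Finset.Icc (-(k : ℤ)) k).filter (fun j => j.natAbs = i) ⊆ {(i : ℤ), -(i : ℤ)} := by
      intro j hj
      have := (Finset.mem_filter.1 hj).2
      simp only [Finset.mem_insert, Finset.mem_singleton]
      omega
    exact_mod_cast (Finset.card_le_card this).trans Finset.card_le_two
  refine (Finset.sum_le_sum h).trans ?_
  rw [← Finset.mul_sum, div_eq_mul_inv]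
  gcongr
  rw [← tsum_geometric_of_lt_one h0 h1]
  exact (summable_geometric_of_lt_one h0 h1).sum_le_tsum _ (fun _ _ => by positivity)

/-- Rankin's trick: weight each vector by x to its ℓ¹ norm, which is at least xᵏ; the weighted sum
over the box factors over coordinates. -/
lemma card_smallCoeffs_mul_pow_le (ι : Type*) [Fintype ι] [DecidableEq ι] {x : ℝ} (h0 : 0 ≤ x)
    (h1 : x < 1) (k : ℕ) :
    (smallCoeffs ι k).card * x ^ k ≤ (2 / (1 - x)) ^ Fintype.card ι := by
  calc (smallCoeffs ι k).card * x ^ k = ∑ _c ∈ smallCoeffs ι k, x ^ k := by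
        rw [Finset.sum_const, nsmul_eq_mul]
    _ ≤ ∑ c ∈ smallCoeffs ι k, ∏ i, x ^ (c i).natAbs := by
        refine Finset.sum_le_sum fun c hc => ?_
        rw [Finset.prod_pow_eq_pow_sum]
        exact pow_le_pow_of_le_one h0 h1.le (mem_smallCoeffs.1 hc)
    _ ≤ ∑ c ∈ Fintype.piFinset fun _ : ι => Finset.Icc (-(k : ℤ)) k, ∏ i, x ^ (c i).natAbs :=
        Finset.sum_le_sum_of_subset_of_nonneg (Finset.filter_subset _ _)
          (fun _ _ _ => by positivity)
    _ = ∏ _i : ι, ∑ j ∈ Finset.Icc (-(k : ℤ)) k, x ^ j.natAbs :=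
        (Finset.prod_univ_sum (fun _ : ι => Finset.Icc (-(k : ℤ)) k)
          fun _ j => x ^ j.natAbs).symm
    _ ≤ (2 / (1 - x)) ^ Fintype.card ι := by
        rw [Finset.prod_const, Finset.card_univ]
        exact pow_le_pow_left₀ (Finset.sum_nonneg fun _ _ => by positivity)
          (sum_pow_natAbs_le h0 h1 k) _

end WordCount

/-! ### The logarithmic lower bound -/

section Labelling

variable {V : Type*} [Fintype V] (G : LoopGraph V) {R : Type*} [AddCommGroup R] (a : V → R)

lemma sumSet_finite : (G.sumSet a).Finite := by
  refine (Set.finite_range fun p : V × V => a p.1 + a p.2).subset ?_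
  rintro _ ⟨u, v, _, rfl⟩
  exact ⟨(u, v), rfl⟩

variable {a}

lemma degree_le_ncard_sumSet (ha : Function.Injective a) (v : V) :
    G.degree v ≤ (G.sumSet a).ncard := by
  unfold degree
  rw [← Set.ncard_coe_finset]
  refine Set.ncard_le_ncard_of_injOn (fun w => a v + a w) ?_ ?_ (G.sumSet_finite a)
  · intro w hw
    simp only [Finset.coe_filter, Finset.mem_univ, true_and, Set.mem_ofPred_eq] at hw
    exact ⟨v, w, hw, rfl⟩
  · intro w _ w' _ h
    exact ha (add_left_cancel h)

lemma vol_le_ncard_sumSet_mul (ha : Function.Injective a) (S : Finset V) :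
    G.vol S ≤ (G.sumSet a).ncard * S.card := by
  rw [mul_comm, ← smul_eq_mul]
  exact Finset.sum_le_card_nsmul _ _ _ fun v _ => G.degree_le_ncard_sumSet ha v

open Classical in
/-- The label of a vertex at distance at most `k` from `v` is `± a v` plus a signed sum of at most
`k` elements of the sum-set. -/
lemma exists_coeffs_of_mem_ball [Fintype (G.sumSet a)] (v : V) (k : ℕ) {w : V}
    (hw : w ∈ G.ball v k) : ∃ (e : ℤˣ) (c : G.sumSet a → ℤ), c ∈ smallCoeffs (G.sumSet a) k ∧
      a w = (e : ℤ) • a v + ∑ t, c t • (t : R) := by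
  induction k generalizing w with
  | zero =>
    simp only [ball, Finset.mem_singleton] at hw
    subst hw
    exact ⟨1, 0, by simp [mem_smallCoeffs], by simp⟩
  | succ k ih =>
    simp only [ball, closedNbhd, Finset.mem_union, Finset.mem_filter, Finset.mem_univ,
      true_and] at hw
    rcases hw with hw | ⟨u, hu, huw⟩
    · obtain ⟨e, c, hc, h⟩ := ih hw
      exact ⟨e, c, mem_smallCoeffs.2 ((mem_smallCoeffs.1 hc).trans (Nat.le_succ k)), h⟩
    · obtain ⟨e, c, hc, h⟩ := ih hu
      let s : G.sumSet a := ⟨a u + a w, u, w, huw, rfl⟩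
      -- Since a w = s − a u, every sign flips and the coefficient of s gains one.
      refine ⟨-e, Pi.single s 1 - c, ?_, ?_⟩
      · rw [mem_smallCoeffs] at hc ⊢
        calc ∑ i, ((Pi.single s 1 - c : G.sumSet a → ℤ) i).natAbs
            ≤ ∑ i, ((Pi.single s 1 : G.sumSet a → ℕ) i + (c i).natAbs) := by
              refine Finset.sum_le_sum fun i _ => ?_
              by_cases hi : i = s
              · subst hi; simp; omega
              · simp [hi]
          _ = 1 + ∑ i, (c i).natAbs := by
              rw [Finset.sum_add_distrib, Finset.sum_pi_single']
              simp
          _ ≤ k + 1 := by omega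
      · have hs : ∑ t, (Pi.single s 1 : G.sumSet a → ℤ) t • (t : R) = a u + a w := by
          rw [Finset.sum_eq_single s]
          · simp [s]
          · intro t _ ht; simp [ht]
          · simp
        simp only [Pi.sub_apply, sub_smul, Finset.sum_sub_distrib, hs, Units.val_neg, neg_smul]
        rw [h]
        abel

lemma card_ball_mul_pow_le (ha : Function.Injective a) (v : V) (k : ℕ) {x : ℝ} (h0 : 0 ≤ x)
    (h1 : x < 1) :
    (G.ball v k).card * x ^ k ≤ 2 * (2 / (1 - x)) ^ (G.sumSet a).ncard := by
  classical
  have : Fintype (G.sumSet a) := (G.sumSet_finite a).fintype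
  have hcard : (G.ball v k).card ≤ 2 * (smallCoeffs (G.sumSet a) k).card := by
    have h2 : ((Finset.univ : Finset ℤˣ) ×ˢ smallCoeffs (G.sumSet a) k).card
        = 2 * (smallCoeffs (G.sumSet a) k).card := by
      rw [Finset.card_product]; rfl
    rw [← h2, ← Finset.card_image_of_injective _ ha]
    refine le_trans (Finset.card_le_card ?_) (Finset.card_image_le
      (f := fun p : ℤˣ × (G.sumSet a → ℤ) => (p.1 : ℤ) • a v + ∑ t, p.2 t • (t : R)))
    intro y hy
    obtain ⟨w, hw, rfl⟩ := Finset.mem_image.1 hy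
    obtain ⟨e, c, hc, h⟩ := G.exists_coeffs_of_mem_ball (a := a) v k hw
    exact Finset.mem_image.2 ⟨(e, c), Finset.mem_product.2 ⟨Finset.mem_univ _, hc⟩, h.symm⟩
  have hw := card_smallCoeffs_mul_pow_le (G.sumSet a) h0 h1 k
  rw [← Nat.card_coe_set_eq, Nat.card_eq_fintype_card]
  calc ((G.ball v k).card : ℝ) * x ^ k ≤ (2 * (smallCoeffs (G.sumSet a) k).card : ℕ) * x ^ k := by
        gcongr
    _ = 2 * ((smallCoeffs (G.sumSet a) k).card * x ^ k) := by push_cast; ring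
    _ ≤ _ := by gcongr

/-- The sum-set along the edges of an expander is at least logarithmic in the number of
vertices. -/
theorem IsExpander.log_le_ncard_sumSet {G : LoopGraph V} {δ : ℝ} (hδ : δ < 1 / 2)
    (hG : G.IsExpander δ) (ha : Function.Injective a) :
    1 / 20 * (Real.log (Fintype.card V) / Real.log (1 / δ)) ≤ ((G.sumSet a).ncard : ℝ) := by
  classical
  have hδ0 : 0 < δ := hG.1
  set n := Fintype.card V with hn
  set m := (G.sumSet a).ncard with hm
  have hlogδ : Real.log 2 ≤ Real.log (1 / δ) :=
    Real.log_le_log (by norm_num) (by rw [le_div_iff₀ hδ0]; linarith)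
  have hlog2 := Real.log_two_gt_d9
  rcases Nat.lt_or_ge n 2 with hn2 | hn2
  · have : Real.log n = 0 := by interval_cases n <;> simp
    rw [this]; simp
  obtain ⟨v⟩ : Nonempty V := Fintype.card_pos_iff.1 (by omega)
  have hm1 : 1 ≤ m :=
    (Nat.one_le_iff_ne_zero.2 (hG.2.1 v)).trans (G.degree_le_ncard_sumSet ha v)
  have hn2' : (2 : ℝ) ≤ n := by exact_mod_cast hn2
  have hlogn : Real.log 2 ≤ Real.log n := Real.log_le_log (by norm_num) hn2'
  have hvol1 : n ≤ G.vol Finset.univ := by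
    have := Finset.card_nsmul_le_sum Finset.univ G.degree 1
      (fun v _ => Nat.one_le_iff_ne_zero.2 (hG.2.1 v))
    simpa [vol] using this
  have hvol2 : G.vol Finset.univ ≤ n ^ 2 := by
    have := Finset.sum_le_card_nsmul Finset.univ G.degree n (fun v _ => Finset.card_le_univ _)
    simpa [vol, sq] using this
  have hlog1 : δ / 2 ≤ Real.log (1 + δ) := by
    have h := Real.one_sub_inv_le_log_of_pos (show 0 < 1 + δ by linarith)
    refine le_trans ?_ h
    have : (1 + δ)⁻¹ ≤ 1 - δ / 2 := by
      rw [inv_le_iff_one_le_mul₀ (by linarith)]; nlinarith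
    linarith
  -- The total volume is at most n², so the ball must pass half of it. Rounding up costs δ < log 2 ≤
  -- log n, whence 5 in place of 4.
  obtain ⟨k, hk1, hk2⟩ : ∃ k : ℕ, (n : ℝ) ^ 2 < (1 + δ) ^ k ∧ k * δ ≤ 5 * Real.log n := by
    refine ⟨⌊4 * Real.log n / δ⌋₊ + 1, ?_, ?_⟩
    · rw [← Real.log_lt_log_iff (by positivity) (by positivity), Real.log_pow, Real.log_pow]
      have h := Nat.lt_floor_add_one (4 * Real.log n / δ)
      rw [div_lt_iff₀ hδ0] at h
      push_cast
      have h2 : ((⌊4 * Real.log n / δ⌋₊ : ℝ) + 1) * (δ / 2)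
          ≤ ((⌊4 * Real.log n / δ⌋₊ : ℝ) + 1) * Real.log (1 + δ) := by gcongr
      linarith
    · have h := Nat.floor_le (show 0 ≤ 4 * Real.log n / δ from
        div_nonneg (by linarith) hδ0.le)
      rw [le_div_iff₀ hδ0] at h
      push_cast
      linarith
  have hball : n ≤ 2 * (m * (G.ball v k).card) := by
    have hb : G.vol Finset.univ < 2 * G.vol (G.ball v k) := by
      refine (G.vol_ball hG v k).resolve_right fun h => ?_
      have h3 : (G.vol (G.ball v k) : ℝ) ≤ (n : ℝ) ^ 2 := by
        exact_mod_cast (G.vol_mono (Finset.subset_univ _)).trans hvol2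
      linarith
    have := G.vol_le_ncard_sumSet_mul ha (G.ball v k)
    rw [← hm] at this
    omega
  -- Chosen so that xᵏ ≥ n^(−1/4), while 1 − x ≥ δ/40.
  set x := Real.exp (-(δ / 20)) with hx
  have hx0 : 0 < x := Real.exp_pos _
  have hx1 : x ≤ 1 - δ / 40 := by
    have h := Real.add_one_le_exp (δ / 20)
    have : x * Real.exp (δ / 20) = 1 := by rw [hx, ← Real.exp_add]; simp
    have h3 : x * (δ / 20 + 1) ≤ 1 := (mul_le_mul_of_nonneg_left h hx0.le).trans_eq this
    nlinarith
  have hcount := G.card_ball_mul_pow_le ha v k hx0.le (by linarith)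
  have hxk : Real.exp (-(Real.log n / 4)) ≤ x ^ k := by
    rw [hx, ← Real.exp_nat_mul]
    apply Real.exp_le_exp.2
    linarith
  have hbase : 2 / (1 - x) ≤ 80 / δ := by
    rw [div_le_div_iff₀ (by linarith) hδ0]; linarith
  have hm2 : (m : ℝ) ≤ 2 ^ m := by exact_mod_cast Nat.lt_two_pow_self.le
  have key : (n : ℝ) * Real.exp (-(Real.log n / 4)) ≤ (640 / δ) ^ m := by
    have hball' : (n : ℝ) ≤ 2 * (m * (G.ball v k).card) := by exact_mod_cast hball
    calc (n : ℝ) * Real.exp (-(Real.log n / 4)) ≤ (2 * (m * (G.ball v k).card)) * x ^ k := by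
          gcongr
      _ = 2 * m * ((G.ball v k).card * x ^ k) := by ring
      _ ≤ 2 * m * (2 * (2 / (1 - x)) ^ m) := by gcongr
      -- The prefactors are absorbed into the base, using m ≤ 2ᵐ and 4 ≤ 4ᵐ: 4 · 2 · 80 = 640.
      _ ≤ 2 * 2 ^ m * (2 * (80 / δ) ^ m) := by
          have : 0 ≤ 2 / (1 - x) := div_nonneg (by norm_num) (by linarith)
          gcongr
      _ = 4 * 2 ^ m * (80 / δ) ^ m := by ring
      _ ≤ 4 ^ m * 2 ^ m * (80 / δ) ^ m := by
          gcongr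
          exact le_self_pow₀ (by norm_num) (by omega)
      _ = (640 / δ) ^ m := by rw [← mul_pow, ← mul_pow]; congr 1; ring
  have hlog := Real.log_le_log (by positivity) key
  rw [Real.log_mul (by positivity) (Real.exp_pos _).ne', Real.log_exp, Real.log_pow] at hlog
  have h640 : Real.log (640 / δ) ≤ 11 * Real.log (1 / δ) := by
    have h1 : Real.log (640 / δ) = Real.log 640 + Real.log (1 / δ) := by
      rw [← Real.log_mul (by norm_num) (by positivity)]; congr 1; ring
    have h2 : Real.log 640 ≤ 10 * Real.log 2 := by
      have : Real.log 640 ≤ Real.log (2 ^ 10) := Real.log_le_log (by norm_num) (by norm_num)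
      rwa [Real.log_pow] at this
    linarith
  have hfin : (m : ℝ) * Real.log (640 / δ) ≤ m * (11 * Real.log (1 / δ)) := by gcongr
  -- What remains is (3/4) log n ≤ 11 m log(1/δ), and 3/44 > 1/20.
  rw [← mul_div_assoc, div_le_iff₀ (by linarith)]
  nlinarith

end Labelling

end LoopGraph

/-! ### Chernoff bound for random subsets -/

section RandomSubset

variable {Λ : Type*} [Fintype Λ] [DecidableEq Λ]

/-- The exponential moment of a centred sum over a random subset of density `p`. -/
lemma sum_finset_weight_mul_exp_le {p l : ℝ} (hp0 : 0 ≤ p) (hp1 : p ≤ 1) (hl0 : 0 ≤ l)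
    (hl1 : l ≤ 1) {r : Λ → ℝ} (hr : ∀ t, |r t| ≤ 1) :
    ∑ T : Finset Λ, p ^ T.card * (1 - p) ^ Tᶜ.card *
      Real.exp (l * (∑ t ∈ T, r t - p * ∑ t, r t)) ≤ Real.exp (l ^ 2 * p * Fintype.card Λ) := by
  -- From eʸ ≤ 1 + y + y² for |y| ≤ 1, followed by 1 + z ≤ eᶻ.
  have hfac : ∀ t, p * Real.exp (l * r t) + (1 - p) ≤ Real.exp (l * p * r t + l ^ 2 * p) := by
    intro t
    have hlr : |l * r t| ≤ 1 := by
      rw [abs_mul, abs_of_nonneg hl0]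
      exact mul_le_one₀ hl1 (abs_nonneg _) (hr t)
    have h1 := (abs_le.1 (Real.abs_exp_sub_one_sub_id_le hlr)).2
    have h2 : (l * r t) ^ 2 ≤ l ^ 2 := by
      rw [mul_pow]
      exact mul_le_of_le_one_right (sq_nonneg l) ((sq_le_one_iff_abs_le_one _).2 (hr t))
    have h3 := Real.add_one_le_exp (l * p * r t + l ^ 2 * p)
    nlinarith
  calc ∑ T : Finset Λ, p ^ T.card * (1 - p) ^ Tᶜ.card *
        Real.exp (l * (∑ t ∈ T, r t - p * ∑ t, r t))
      = Real.exp (-(l * p * ∑ t, r t)) *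
          ∑ T : Finset Λ, (∏ t ∈ T, p * Real.exp (l * r t)) * ∏ _t ∈ Tᶜ, (1 - p) := by
        rw [Finset.mul_sum (s := (Finset.univ : Finset (Finset Λ)))]
        refine Finset.sum_congr rfl fun T _ => ?_
        rw [Finset.prod_mul_distrib, Finset.prod_const, Finset.prod_const, ← Real.exp_sum,
          ← Finset.mul_sum,
          show l * (∑ t ∈ T, r t - p * ∑ t, r t) = -(l * p * ∑ t, r t) + l * ∑ t ∈ T, r t by ring,
          Real.exp_add]
        ring
    _ = Real.exp (-(l * p * ∑ t, r t)) * ∏ t, (p * Real.exp (l * r t) + (1 - p)) := by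
        rw [Fintype.prod_add]
    _ ≤ Real.exp (-(l * p * ∑ t, r t)) * ∏ t, Real.exp (l * p * r t + l ^ 2 * p) := by
        refine mul_le_mul_of_nonneg_left (Finset.prod_le_prod (fun t _ => ?_) fun t _ => hfac t)
          (Real.exp_pos _).le
        have := Real.exp_pos (l * r t)
        have : 0 ≤ 1 - p := by linarith
        positivity
    _ = Real.exp (l ^ 2 * p * Fintype.card Λ) := by
        rw [← Real.exp_sum, ← Real.exp_add, Finset.sum_add_distrib, ← Finset.mul_sum,
          Finset.sum_const, Finset.card_univ, nsmul_eq_mul]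
        ring_nf

/-- Some subset of density about `p` has small deviation for all of finitely many bounded
functions. -/
lemma exists_finset_deviation_le {ι : Type*} [Fintype ι] [Nonempty ι] {p l : ℝ} (hp0 : 0 < p)
    (hp1 : p < 1) (hl0 : 0 < l) (hl1 : l ≤ 1) {r : ι → Λ → ℝ} (hr : ∀ i t, |r i t| ≤ 1) :
    ∃ T : Finset Λ, ∀ i, ∑ t ∈ T, r i t - p * ∑ t, r i t ≤
      Real.log (Fintype.card ι) / l + l * p * Fintype.card Λ := by
  set B := Fintype.card ι * Real.exp (l ^ 2 * p * Fintype.card Λ) with hB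
  have hw : ∑ T : Finset Λ, p ^ T.card * (1 - p) ^ Tᶜ.card = 1 := by
    have h := Fintype.prod_add (fun _ : Λ => p) (fun _ => 1 - p)
    simp only [Finset.prod_const] at h
    rw [← h]; simp
  -- Union bound by averaging: some T makes the sum of all the exponentials at most B, hence each
  -- one.
  have hsum : ∑ T : Finset Λ, p ^ T.card * (1 - p) ^ Tᶜ.card *
      ∑ i, Real.exp (l * (∑ t ∈ T, r i t - p * ∑ t, r i t)) ≤
      ∑ T : Finset Λ, p ^ T.card * (1 - p) ^ Tᶜ.card * B := by
    rw [← Finset.sum_mul, hw, one_mul]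
    rw [Finset.sum_congr rfl fun T _ => Finset.mul_sum _ _ _, Finset.sum_comm]
    refine (Finset.sum_le_sum fun i _ =>
      sum_finset_weight_mul_exp_le hp0.le hp1.le hl0.le hl1 (hr i)).trans_eq ?_
    rw [Finset.sum_const, Finset.card_univ, nsmul_eq_mul]
  obtain ⟨T, -, hT⟩ := Finset.exists_le_of_sum_le Finset.univ_nonempty hsum
  have hq : 0 < 1 - p := by linarith
  have hT' := le_of_mul_le_mul_left hT (by positivity)
  refine ⟨T, fun i => ?_⟩
  have h := (Finset.single_le_sum (f := fun i => Real.exp (l * (∑ t ∈ T, r i t - p * ∑ t, r i t)))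
    (fun _ _ => (Real.exp_pos _).le) (Finset.mem_univ i)).trans hT'
  have h2 := Real.log_le_log (Real.exp_pos _) h
  have hι : (Fintype.card ι : ℝ) ≠ 0 := by exact_mod_cast Fintype.card_ne_zero
  rw [Real.log_exp, hB, Real.log_mul hι (Real.exp_pos _).ne', Real.log_exp] at h2
  rw [← mul_le_mul_iff_right₀ hl0]
  refine h2.trans_eq ?_
  field_simp

end RandomSubset

/-! ### Character sums: random sets, orthogonality, Parseval -/

section CharacterSums

variable {Λ : Type*} [AddCommGroup Λ] [Fintype Λ] [DecidableEq Λ]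

/-- The real parts of D, iD, −D, −iD control |D|; these four rotations of each character account for
the 4 in the logarithm. -/
lemma exists_finset_norm_charSum_le {p l : ℝ} (hp0 : 0 < p) (hp1 : p < 1) (hl0 : 0 < l)
    (hl1 : l ≤ 1) : ∃ T : Finset Λ, ∀ ψ : AddChar Λ ℂ,
      ‖∑ t ∈ T, ψ t - p * ∑ t, ψ t‖ ≤
        2 * (Real.log (4 * Fintype.card Λ) / l + l * p * Fintype.card Λ) := by
  obtain ⟨T, hT⟩ := exists_finset_deviation_le (Λ := Λ) (ι := AddChar Λ ℂ × Fin 4) hp0 hp1 hl0 hl1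
    (r := fun i t => (Complex.I ^ (i.2 : ℕ) * i.1 t).re) (by
      intro i t
      refine (Complex.abs_re_le_norm _).trans ?_
      simp)
  refine ⟨T, fun ψ => ?_⟩
  rw [Fintype.card_prod, AddChar.card_eq, Fintype.card_fin, mul_comm (Fintype.card Λ) 4] at hT
  push_cast at hT
  set B := Real.log (4 * Fintype.card Λ) / l + l * p * Fintype.card Λ
  set D := ∑ t ∈ T, ψ t - p * ∑ t, ψ t with hD
  have key : ∀ j : Fin 4, (Complex.I ^ (j : ℕ) * D).re ≤ B := by
    intro j
    refine le_trans (le_of_eq ?_) (hT (ψ, j))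
    simp only [← Complex.re_sum, ← Finset.mul_sum]
    rw [hD, ← Complex.re_ofReal_mul, ← Complex.sub_re]
    congr 1
    ring
  have h0 := key 0
  have h1 := key 1
  have h2 := key 2
  have h3 := key 3
  simp [pow_succ] at h0 h1 h2 h3
  have hre : |D.re| ≤ B := abs_le.2 ⟨by linarith, h0⟩
  have him : |D.im| ≤ B := abs_le.2 ⟨by linarith, by linarith⟩
  linarith [Complex.norm_le_abs_re_add_abs_im D]

lemma sum_addChar_sum_mul_sum (S S' : Finset Λ) (T : Finset Λ) :
    ∑ ψ : AddChar Λ ℂ, (∑ t ∈ T, ψ (-t)) * ((∑ y ∈ S, ψ y) * ∑ z ∈ S', ψ z) =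
      Fintype.card Λ * ((S ×ˢ S').filter fun q => q.1 + q.2 ∈ T).card := by
  calc ∑ ψ : AddChar Λ ℂ, (∑ t ∈ T, ψ (-t)) * ((∑ y ∈ S, ψ y) * ∑ z ∈ S', ψ z)
      = ∑ ψ : AddChar Λ ℂ, ∑ q ∈ S ×ˢ S', ∑ t ∈ T, ψ (q.1 + q.2 - t) := by
        refine Finset.sum_congr rfl fun ψ _ => ?_
        rw [Finset.sum_mul_sum, ← Finset.sum_product', mul_comm, Finset.sum_mul_sum]
        refine Finset.sum_congr rfl fun q _ => Finset.sum_congr rfl fun t _ => ?_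
        rw [sub_eq_add_neg, AddChar.map_add_eq_mul, AddChar.map_add_eq_mul]
    _ = ∑ q ∈ S ×ˢ S', ∑ t ∈ T, ∑ ψ : AddChar Λ ℂ, ψ (q.1 + q.2 - t) := by
        rw [Finset.sum_comm]
        exact Finset.sum_congr rfl fun q _ => Finset.sum_comm
    _ = ∑ q ∈ S ×ˢ S', if q.1 + q.2 ∈ T then (Fintype.card Λ : ℂ) else 0 := by
        refine Finset.sum_congr rfl fun q _ => ?_
        simp_rw [AddChar.sum_apply_eq_ite, sub_eq_zero]
        rw [Finset.sum_ite_eq]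
    _ = _ := by
        rw [← Finset.sum_filter, Finset.sum_const, nsmul_eq_mul, mul_comm]

lemma sum_norm_sq_charSum (S : Finset Λ) :
    ∑ ψ : AddChar Λ ℂ, ‖∑ y ∈ S, ψ y‖ ^ 2 = Fintype.card Λ * (S.card : ℝ) := by
  have h : ∑ ψ : AddChar Λ ℂ, ((‖∑ y ∈ S, ψ y‖ ^ 2 : ℝ) : ℂ) = Fintype.card Λ * (S.card : ℂ) := by
    calc ∑ ψ : AddChar Λ ℂ, ((‖∑ y ∈ S, ψ y‖ ^ 2 : ℝ) : ℂ)
        = ∑ ψ : AddChar Λ ℂ, ∑ y ∈ S, ∑ z ∈ S, ψ (y - z) := by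
          refine Finset.sum_congr rfl fun ψ _ => ?_
          rw [Complex.ofReal_pow, ← Complex.mul_conj', map_sum, Finset.sum_mul_sum]
          refine Finset.sum_congr rfl fun y _ => Finset.sum_congr rfl fun z _ => ?_
          rw [sub_eq_add_neg, AddChar.map_add_eq_mul, AddChar.map_neg_eq_conj]
      _ = ∑ y ∈ S, ∑ z ∈ S, ∑ ψ : AddChar Λ ℂ, ψ (y - z) := by
          rw [Finset.sum_comm]
          exact Finset.sum_congr rfl fun q _ => Finset.sum_comm
      _ = ∑ y ∈ S, (Fintype.card Λ : ℂ) := by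
          refine Finset.sum_congr rfl fun y hy => ?_
          simp_rw [AddChar.sum_apply_eq_ite, sub_eq_zero]
          rw [Finset.sum_ite_eq, if_pos hy]
      _ = _ := by rw [Finset.sum_const, nsmul_eq_mul, mul_comm]
  exact_mod_cast h

end CharacterSums

namespace LoopGraph

/-! ### Expansion of Cayley sum graphs -/

section CayleySum

variable {Λ : Type*} [AddCommGroup Λ] [Fintype Λ]

lemma cayleySum_isRegular (T : Finset Λ) : (cayleySum T).IsRegular T.card := by
  classical
  intro v
  unfold degree
  refine Finset.card_bij (fun w _ => v + w) ?_ ?_ ?_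
  · intro w hw
    exact (Finset.mem_filter.1 hw).2
  · intro w _ w' _ h
    exact add_left_cancel h
  · intro t ht
    exact ⟨t - v, Finset.mem_filter.2 ⟨Finset.mem_univ _, by simpa [cayleySum] using ht⟩, by simp⟩

lemma vol_cayleySum (T S : Finset Λ) : (cayleySum T).vol S = S.card * T.card := by
  unfold vol
  rw [Finset.sum_congr rfl fun v _ => cayleySum_isRegular T v, Finset.sum_const, smul_eq_mul]

/-- The expander mixing lower bound for a cut in a Cayley sum graph. -/
lemma mul_card_le_cut_cayleySum {T : Finset Λ} {ε : ℝ}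
    (hT : ∀ ψ : AddChar Λ ℂ, ψ ≠ 0 → ‖∑ t ∈ T, ψ t‖ ≤ ε * T.card) (S : Finset Λ) :
    (1 - ε) * T.card * (S.card * (Fintype.card Λ - S.card)) ≤
      Fintype.card Λ * ((cayleySum T).cut S : ℝ) := by
  classical
  set n : ℝ := (Fintype.card Λ : ℝ) with hn
  have hcut : (Fintype.card Λ * ((cayleySum T).cut S : ℂ)) =
      ∑ ψ : AddChar Λ ℂ, (∑ t ∈ T, ψ (-t)) * ((∑ y ∈ S, ψ y) * ∑ z ∈ Sᶜ, ψ z) := by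
    rw [sum_addChar_sum_mul_sum]
    congr 2
    unfold cut
    congr 1
    ext q
    rw [Finset.mem_filter, Finset.mem_filter]
    rfl
  have hScard : ((Sᶜ.card : ℕ) : ℝ) = n - S.card := by
    rw [Finset.card_compl, Nat.cast_sub (Finset.card_le_univ S)]
  have hzero : (∑ t ∈ T, (0 : AddChar Λ ℂ) (-t)) * ((∑ y ∈ S, (0 : AddChar Λ ℂ) y) *
      ∑ z ∈ Sᶜ, (0 : AddChar Λ ℂ) z) = ((T.card * (S.card * (n - S.card)) : ℝ) : ℂ) := by
    rw [← hScard]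
    simp
  have hterm : ∀ ψ ∈ Finset.univ.erase (0 : AddChar Λ ℂ),
      ‖(∑ t ∈ T, ψ (-t)) * ((∑ y ∈ S, ψ y) * ∑ z ∈ Sᶜ, ψ z)‖ ≤
        ε * T.card * ‖∑ y ∈ S, ψ y‖ ^ 2 := by
    intro ψ hψ
    have hψ : ψ ≠ 0 := Finset.ne_of_mem_erase hψ
    -- The sum of ψ over the whole group vanishes, so the two factors have equal norm and Parseval
    -- applies directly.
    have h1 : ∑ z ∈ Sᶜ, ψ z = -∑ y ∈ S, ψ y := by
      rw [eq_neg_iff_add_eq_zero, add_comm, Finset.sum_add_sum_compl, AddChar.sum_eq_ite,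
        if_neg hψ]
    have h2 : ‖∑ t ∈ T, ψ (-t)‖ = ‖∑ t ∈ T, ψ t‖ := by
      simp_rw [AddChar.map_neg_eq_conj]
      rw [← map_sum, Complex.norm_conj]
    rw [norm_mul, norm_mul, h1, norm_neg, h2, ← sq]
    gcongr
    exact hT ψ hψ
  have hpars : ∑ ψ ∈ Finset.univ.erase (0 : AddChar Λ ℂ), ‖∑ y ∈ S, ψ y‖ ^ 2 =
      S.card * (n - S.card) := by
    have h := sum_norm_sq_charSum S
    rw [← Finset.add_sum_erase _ _ (Finset.mem_univ 0)] at h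
    simp only [AddChar.zero_apply, Finset.sum_const, nsmul_eq_mul, mul_one,
      Complex.norm_natCast] at h
    linarith
  have hdiff : ‖(Fintype.card Λ * ((cayleySum T).cut S : ℂ)) -
      ((T.card * (S.card * (n - S.card)) : ℝ) : ℂ)‖ ≤ ε * T.card * (S.card * (n - S.card)) := by
    rw [hcut, ← Finset.add_sum_erase _ _ (Finset.mem_univ 0), hzero, add_sub_cancel_left,
      ← hpars, Finset.mul_sum]
    exact norm_sum_le_of_le _ hterm
  have hreal : (Fintype.card Λ * ((cayleySum T).cut S : ℂ)) -
      ((T.card * (S.card * (n - S.card)) : ℝ) : ℂ) =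
      ((n * (cayleySum T).cut S - T.card * (S.card * (n - S.card)) : ℝ) : ℂ) := by
    push_cast [hn]; rfl
  rw [hreal, Complex.norm_real, Real.norm_eq_abs] at hdiff
  have := (abs_le.1 hdiff).1
  linarith

lemma cayleySum_isExpander {T : Finset Λ} (hT0 : T.Nonempty) {δ ε : ℝ} (hδ : 0 < δ)
    (hε : 2 * δ < 1 - ε)
    (hT : ∀ ψ : AddChar Λ ℂ, ψ ≠ 0 → ‖∑ t ∈ T, ψ t‖ ≤ ε * T.card) :
    (cayleySum T).IsExpander δ := by
  classical
  have hTpos : (0 : ℝ) < T.card := by exact_mod_cast hT0.card_pos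
  refine ⟨hδ, fun v => by rw [cayleySum_isRegular T v]; exact hT0.card_pos.ne', ?_⟩
  rw [lt_conductance_iff _ hδ.le]
  intro S hS hS'
  rw [vol_cayleySum] at hS hS'
  rw [vol_cayleySum, vol_cayleySum]
  have h1 : (0 : ℝ) < S.card := by exact_mod_cast Nat.pos_of_ne_zero (left_ne_zero_of_mul hS)
  have h2 : (0 : ℝ) < Sᶜ.card := by exact_mod_cast Nat.pos_of_ne_zero (left_ne_zero_of_mul hS')
  have h := mul_card_le_cut_cayleySum hT S
  have hn : (Fintype.card Λ : ℝ) = S.card + Sᶜ.card := by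
    exact_mod_cast (Finset.card_add_card_compl S).symm
  rw [hn, add_sub_cancel_left] at h
  set s : ℝ := (S.card : ℝ)
  set s' : ℝ := (Sᶜ.card : ℝ)
  set d : ℝ := (T.card : ℝ)
  -- (s + s') min(s, s') ≤ 2ss': the source of the factor 2 in `hε`, and so of the threshold 1/2.
  have hmin : (s + s') * (min (S.card * T.card) (Sᶜ.card * T.card) : ℕ) ≤ 2 * (d * (s * s')) := by
    have e1 : ((min (S.card * T.card) (Sᶜ.card * T.card) : ℕ) : ℝ) ≤ s * d := by
      rw [← Nat.cast_mul]
      exact Nat.cast_le.2 (min_le_left _ _)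
    have e2 : ((min (S.card * T.card) (Sᶜ.card * T.card) : ℕ) : ℝ) ≤ s' * d := by
      rw [← Nat.cast_mul]
      exact Nat.cast_le.2 (min_le_right _ _)
    nlinarith
  have hlt : 2 * δ * (d * (s * s')) < (1 - ε) * (d * (s * s')) := by gcongr
  refine lt_of_mul_lt_mul_left ?_ (show 0 ≤ s + s' by positivity)
  nlinarith

/-- Every finite abelian group of order at least two has a Cayley sum graph of logarithmic degree
that is a `δ`-expander. -/
theorem exists_cayleySum_isExpander {δ : ℝ} (hδ : 0 < δ) (hδ' : δ < 1 / 2)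
    (hn2 : 2 ≤ Fintype.card Λ) : ∃ T : Finset Λ,
      (T.card : ℝ) ≤ 1536 / (1 - 2 * δ) ^ 2 * Real.log (Fintype.card Λ) ∧
      (cayleySum T).IsExpander δ := by
  classical
  set n : ℝ := (Fintype.card Λ : ℝ) with hn
  set η := 1 - 2 * δ with hη
  have hη0 : 0 < η := by linarith
  have hη1 : η < 1 := by linarith
  have hn2' : (2 : ℝ) ≤ n := by rw [hn]; exact_mod_cast hn2
  have hlog : 0 < Real.log n := Real.log_pos (by linarith)
  -- If n is too small for a density below 1, the whole group serves: its nontrivial character sums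
  -- vanish.
  rcases le_or_gt n (768 / η ^ 2 * Real.log n) with hsmall | hlarge
  · refine ⟨Finset.univ, ?_, cayleySum_isExpander (ε := 0) ?_ hδ (by linarith) ?_⟩
    · rw [Finset.card_univ]
      refine hsmall.trans ?_
      gcongr
      norm_num
    · rw [← Finset.card_pos, Finset.card_univ]; omega
    · intro ψ hψ
      rw [AddChar.sum_eq_ite, if_neg hψ]
      simp
  · set p := 768 / η ^ 2 * Real.log n / n with hp
    have hpn : p * n = 768 / η ^ 2 * Real.log n := by rw [hp]; field_simp
    have hp0 : 0 < p := by positivity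
    have hp1 : p < 1 := by rw [hp, div_lt_one (by linarith)]; exact hlarge
    have hpn0 : 0 < p * n := by positivity
    -- With l = η/16 and pn = 768 log n / η², both error terms are at most (η/16)pn.
    obtain ⟨T, hT⟩ := exists_finset_norm_charSum_le (Λ := Λ) hp0 hp1 (l := η / 16) (by linarith)
      (by linarith)
    have hlog4 : Real.log (4 * n) ≤ 3 * Real.log n := by
      have h2 : Real.log (2 ^ 2) ≤ 2 * Real.log n := by
        rw [Real.log_pow]
        push_cast
        gcongr
      rw [Real.log_mul (by norm_num) (by linarith)]
      norm_num at h2 ⊢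
      linarith
    have hB : 2 * (Real.log (4 * n) / (η / 16) + η / 16 * p * n) ≤ η / 4 * (p * n) := by
      have h1 : Real.log (4 * n) / (η / 16) ≤ η / 16 * (p * n) := by
        rw [div_le_iff₀ (by linarith), hpn]
        refine hlog4.trans_eq ?_
        field_simp
        norm_num
      linarith
    replace hT := fun ψ => (hT ψ).trans hB
    -- The trivial character controls |T|.
    have hcard : |(T.card : ℝ) - p * n| ≤ η / 4 * (p * n) := by
      have h := hT 0
      simp only [AddChar.zero_apply, Finset.sum_const, nsmul_eq_mul, mul_one,
        Finset.card_univ] at h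
      rw [← Real.norm_eq_abs, ← Complex.norm_real]
      push_cast [hn]
      exact h
    rw [abs_le] at hcard
    have hlow : 3 / 4 * (p * n) ≤ T.card := by nlinarith
    refine ⟨T, ?_, cayleySum_isExpander (ε := η / 3) ?_ hδ (by linarith) ?_⟩
    · have : (T.card : ℝ) ≤ 2 * (p * n) := by nlinarith
      refine this.trans_eq ?_
      rw [hpn]; ring
    · rw [← Finset.card_pos]
      have : (0 : ℝ) < T.card := by linarith
      exact_mod_cast this
    · intro ψ hψ
      have h := hT ψ
      rw [AddChar.sum_eq_ite, if_neg hψ, mul_zero, sub_zero] at h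
      refine h.trans ?_
      nlinarith

/-- The lower bound allows labels in any abelian group; under the identity labelling by `Λ` the
sum-set lies in `T`. -/
lemma log_le_card_of_cayleySum_isExpander {T : Finset Λ} {δ : ℝ} (hδ : δ < 1 / 2)
    (hT : (cayleySum T).IsExpander δ) :
    1 / 20 * (Real.log (Fintype.card Λ) / Real.log (1 / δ)) ≤ T.card := by
  refine (hT.log_le_ncard_sumSet hδ (a := id) Function.injective_id).trans ?_
  rw [← Set.ncard_coe_finset T]
  have hsub : (cayleySum T).sumSet id ⊆ (T : Set Λ) := by
    rintro _ ⟨u, v, h, rfl⟩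
    exact h
  exact_mod_cast Set.ncard_le_ncard hsub T.finite_toSet

end CayleySum

/-! ### Integer labels for residues -/

section ZModLabelling

/-- The representative in `{1, …, n}` of a residue class modulo `n`. -/
def zmodLabel (n : ℕ) (y : ZMod n) : ℤ := (y - 1).val + 1

variable {n : ℕ} [NeZero n]

lemma zmodLabel_cast (y : ZMod n) : (zmodLabel n y : ZMod n) = y := by
  simp [zmodLabel]

lemma zmodLabel_injective : Function.Injective (zmodLabel n) :=
  Function.LeftInverse.injective (g := fun x : ℤ => (x : ZMod n)) zmodLabel_cast

lemma zmodLabel_mem (y : ZMod n) : zmodLabel n y ∈ Set.Icc 1 (n : ℤ) := by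
  have := (y - 1).val_lt
  simp only [zmodLabel, Set.mem_Icc]
  omega

lemma range_zmodLabel : Set.range (zmodLabel n) = Set.Icc 1 (n : ℤ) := by
  ext x
  refine ⟨?_, fun hx => ⟨(x : ZMod n), ?_⟩⟩
  · rintro ⟨y, rfl⟩
    exact zmodLabel_mem y
  · have h := zmodLabel_mem (x : ZMod n)
    have hd := (ZMod.intCast_eq_intCast_iff_dvd_sub _ _ n).1 (zmodLabel_cast (x : ZMod n))
    rw [Set.mem_Icc] at h hx
    have := Int.eq_zero_of_abs_lt_dvd hd (by rw [abs_lt]; omega)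
    omega

/-- Two labels sum to a number in [2, 2n], so it exceeds the label of y + z by 0 or n. -/
lemma ncard_sumSet_zmodLabel_le (T : Finset (ZMod n)) :
    ((cayleySum T).sumSet (zmodLabel n)).ncard ≤ 2 * T.card := by
  classical
  have hsub : (cayleySum T).sumSet (zmodLabel n) ⊆
      ((T ×ˢ ({0, 1} : Finset ℤ)).image fun q => zmodLabel n q.1 + q.2 * n : Finset ℤ) := by
    rintro _ ⟨y, z, hyz, rfl⟩
    have hy := zmodLabel_mem y
    have hz := zmodLabel_mem z
    have hs := zmodLabel_mem (y + z)
    rw [Set.mem_Icc] at hy hz hs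
    obtain ⟨e, he⟩ := (ZMod.intCast_eq_intCast_iff_dvd_sub (zmodLabel n (y + z))
      (zmodLabel n y + zmodLabel n z) n).1 (by push_cast; simp only [zmodLabel_cast])
    have hn : (0 : ℤ) < n := by exact_mod_cast Nat.pos_of_ne_zero (NeZero.ne n)
    have h1 : -1 < e := by
      by_contra! h
      nlinarith
    have h2 : e < 2 := by
      by_contra! h
      nlinarith
    rw [Finset.mem_coe, Finset.mem_image]
    refine ⟨(y + z, e), Finset.mem_product.2 ⟨hyz, ?_⟩, ?_⟩
    · simp only [Finset.mem_insert, Finset.mem_singleton]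
      omega
    · simp only
      linarith
  refine (Set.ncard_le_ncard hsub (Finset.finite_toSet _)).trans ?_
  rw [Set.ncard_coe_finset]
  refine Finset.card_image_le.trans ?_
  rw [Finset.card_product, mul_comm]
  simp

end ZModLabelling

end LoopGraph

theorem theorem5 :
    (∀ δ : ℝ, 0 < δ → δ < 1 / 2 → ∃ C c : ℝ, 0 < C ∧ 0 < c ∧
      (∀ (n : ℕ) (V : Type*) [Fintype V] (G : LoopGraph V), Fintype.card V = n →
        G.IsExpander δ → ∀ a : V → ℤ, Function.Injective a →
          c * Real.log n ≤ ((G.sumSet a).ncard : ℝ)) ∧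
      (∀ (n : ℕ) [NeZero n], 2 ≤ n → ∃ T : Finset (ZMod n),
        c * Real.log n ≤ (T.card : ℝ) ∧ (T.card : ℝ) ≤ C * Real.log n ∧
        (LoopGraph.cayleySum T).IsRegular T.card ∧
        (LoopGraph.cayleySum T).IsExpander δ ∧
        ∃ a : ZMod n → ℤ, Function.Injective a ∧ Set.range a = Set.Icc 1 (n : ℤ) ∧
          (∀ y, (a y : ZMod n) = y) ∧
          (((LoopGraph.cayleySum T).sumSet a).ncard : ℝ) ≤ C * Real.log n)) ∧
    (∃ c₀ : ℝ, 0 < c₀ ∧ ∀ δ : ℝ, 0 < δ → δ < 1 / 2 →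
      ∀ (n : ℕ) (V : Type*) [Fintype V] (G : LoopGraph V), Fintype.card V = n →
        G.IsExpander δ → ∀ a : V → ℤ, Function.Injective a →
          c₀ * (Real.log n / Real.log (1 / δ)) ≤ ((G.sumSet a).ncard : ℝ)) := by
  constructor
  · intro δ hδ hδ'
    have hlogδ : 0 < Real.log (1 / δ) := Real.log_pos (by rw [lt_div_iff₀ hδ]; linarith)
    have hη : 0 < 1 - 2 * δ := by linarith
    refine ⟨2 * (1536 / (1 - 2 * δ) ^ 2), 1 / 20 / Real.log (1 / δ), by positivity, by positivity,
      ?_, ?_⟩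
    · rintro n V _ G rfl hG a ha
      refine le_trans (le_of_eq ?_) (hG.log_le_ncard_sumSet hδ' ha)
      ring
    · intro n _ hn
      obtain ⟨T, hT, hexp⟩ := LoopGraph.exists_cayleySum_isExpander (Λ := ZMod n) hδ hδ'
        (by rwa [ZMod.card])
      have hlow := LoopGraph.log_le_card_of_cayleySum_isExpander hδ' hexp
      rw [ZMod.card] at hT hlow
      refine ⟨T, le_trans (le_of_eq ?_) hlow, ?_, LoopGraph.cayleySum_isRegular T, hexp,
        LoopGraph.zmodLabel n, LoopGraph.zmodLabel_injective, LoopGraph.range_zmodLabel,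
        LoopGraph.zmodLabel_cast, ?_⟩
      · ring
      · have : (0 : ℝ) ≤ T.card := Nat.cast_nonneg _
        linarith
      · have : (((LoopGraph.cayleySum T).sumSet (LoopGraph.zmodLabel n)).ncard : ℝ)
            ≤ 2 * T.card := by
          exact_mod_cast LoopGraph.ncard_sumSet_zmodLabel_le T
        linarith
  · refine ⟨1 / 20, by norm_num, ?_⟩
    rintro δ _ hδ' n V _ G rfl hG a ha
    exact hG.log_le_ncard_sumSet hδ' ha
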